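/- A circuit with $n$ inputs and $m$ outputs over arbitrary gates is a finite directed acyclic graph whose nodes are the $n$ input variables and a finite number of gates. Each gate has unbounded fan-in and computes an arbitrary Boolean function of the bits on its incoming wires (edges), and each of the $m$ output bits is read off at some node. The number of wires is the number of edges, and the depth is the number of edges on a longest directed path ending in an output node. For $M \in \mathbb{F}_2^{m \times n}$, a circuit $C$ computes $M$ if $C(x) = Mx$ for all $x \in \{0,1\}^n$. It has advantage $\varepsilon$ for $M$ if $$\Pr_{x \in \{0,1\}^n}\left[ C_i(x) = (Mx)_i \right] \ge \frac{1+\varepsilon}{2} \quad \text{for every } i \in \{1,\dots,m\},$$ where $x$ is uniformly random. A property holds for most linear operators $\{0,1\}^n \to \{0,1\}^{O(n)}$ if for every constant $K \in \mathbb{N}$ and every $\eta > 0$ there is an $N$ such that, for all $n \ge N$ and all $m$ with $n \le m \le Kn$, at least a $1-\eta$ fraction of the matrices $M \in \mathbb{F}_2^{m \times n}$ have it. **Theorem.** (1) There is an absolute constant $c > 0$ such that most linear operators $M : \{0,1\}^n \to \{0,1\}^{O(n)}$ have the following property: for every $d \ge 1$, every circuit of depth at most $d$ with arbitrary gates of unbounded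 fan-in that computes $M$ has at least $c \cdot n \cdot (\log_2 n)^{1/d}$ wires. (2) For every constant $\varepsilon > 0$ there is a constant $c = c(\varepsilon) > 0$ such that most linear operators $M : \{0,1\}^n \to \{0,1\}^{O(n)}$ have the following property: for every $d \ge 1$, every circuit of depth at most $d$ with arbitrary gates of unbounded fan-in that has advantage $\varepsilon$ for $M$ has at least $c \cdot n \cdot (\log_2 n)^{1/d}$ wires. -/

import Mathlib

/-- A Boolean circuit with `n` inputs and `m` outputs over arbitrary gates of unbounded fan-in.
The nodes are the `n` input variables (`Sum.inl`) and `size` gates (`Sum.inr`), the gates being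
listed in a topological order of the underlying directed acyclic graph. -/
structure Circuit (n m : ℕ) where
  /-- number of gates -/
  size : ℕ
  /-- the nodes from which a wire leads into the gate `g` -/
  preds : Fin size → Finset (Fin n ⊕ Fin size)
  /-- wires go forward in the order of the gates, so the graph is acyclic -/
  acyclic : ∀ g h : Fin size, Sum.inr h ∈ preds g → h < g
  /-- an arbitrary Boolean function of the incoming bits at each gate -/
  op : (g : Fin size) → (preds g → ZMod 2) → ZMod 2
  /-- the node at which each output bit is read off -/
  out : Fin m → Fin n ⊕ Fin size

namespace Circuit

variable {n m : ℕ} (C : Circuit n m)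

/-- The bit computed by a gate on the input `x`. -/
def gateVal (x : Fin n → ZMod 2) (g : Fin C.size) : ZMod 2 :=
  C.op g fun v =>
    match hv : v.1 with
    | Sum.inl i => x i
    | Sum.inr h => gateVal x h
termination_by g
decreasing_by exact C.acyclic g h (hv ▸ v.2)

/-- The bit carried by a node on the input `x`. -/
def nodeVal (x : Fin n → ZMod 2) : Fin n ⊕ Fin C.size → ZMod 2
  | Sum.inl i => x i
  | Sum.inr g => C.gateVal x g

/-- The `i`-th output bit on the input `x`. -/
def eval (x : Fin n → ZMod 2) (i : Fin m) : ZMod 2 :=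
  C.nodeVal x (C.out i)

/-- The number of wires on a longest path that ends in the gate `g`. -/
def gateDepth (g : Fin C.size) : ℕ :=
  (C.preds g).attach.sup fun v =>
    match hv : v.1 with
    | Sum.inl _ => 1
    | Sum.inr h => gateDepth h + 1
termination_by g
decreasing_by exact C.acyclic g h (hv ▸ v.2)

/-- The number of wires on a longest path that ends in a given node. -/
def nodeDepth : Fin n ⊕ Fin C.size → ℕ
  | Sum.inl _ => 0
  | Sum.inr g => C.gateDepth g

/-- The depth of the circuit: the number of wires on a longest path that ends in an output node. -/
def depth : ℕ :=
  Finset.univ.sup fun i : Fin m => C.nodeDepth (C.out i)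

/-- The total number of wires of the circuit. -/
def wires : ℕ :=
  ∑ g : Fin C.size, (C.preds g).card

/-- A gate applies its function to the bits carried by the nodes wired into it. -/
theorem gateVal_eq (x : Fin n → ZMod 2) (g : Fin C.size) :
    C.gateVal x g = C.op g fun v => C.nodeVal x v.1 := by
  rw [gateVal]
  congr 1
  funext v
  rcases v with ⟨_ | _, _⟩ <;> rfl

/-- A gate lies one level above the deepest node wired into it. -/
theorem gateDepth_eq (g : Fin C.size) :
    C.gateDepth g = (C.preds g).sup fun v => C.nodeDepth v + 1 := by
  rw [gateDepth, ← Finset.sup_attach (C.preds g) fun v => C.nodeDepth v + 1]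
  congr 1
  funext v
  rcases v with ⟨_ | _, _⟩ <;> rfl

/-- The circuit computes the linear operator `x ↦ M x` over `𝔽₂`. -/
def Computes (M : Matrix (Fin m) (Fin n) (ZMod 2)) : Prop :=
  ∀ x : Fin n → ZMod 2, C.eval x = M.mulVec x

/-- Every single output bit of the circuit agrees with that of `x ↦ M x` with probability at least
`(1 + ε) / 2` over a uniformly random input `x`. -/
def HasAdvantage (ε : ℝ) (M : Matrix (Fin m) (Fin n) (ZMod 2)) : Prop :=
  ∀ i : Fin m,
    (1 + ε) / 2 ≤
      ((Finset.univ.filter fun x : Fin n → ZMod 2 => C.eval x i = M.mulVec x i).card : ℝ) / 2 ^ n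

end Circuit

/-- `P` holds for most linear operators `𝔽₂ⁿ → 𝔽₂^{O(n)}`: for every constant `K`, the fraction of
the `m × n` matrices over `𝔽₂` with the property `P` tends to `1` as `n → ∞`, uniformly in the
number `m` of outputs with `n ≤ m ≤ K n`. -/
def ForMostOperators (P : (n m : ℕ) → Matrix (Fin m) (Fin n) (ZMod 2) → Prop) : Prop :=
  ∀ K : ℕ, ∀ η : ℝ, 0 < η → ∀ᶠ n : ℕ in Filter.atTop, ∀ m : ℕ, n ≤ m → m ≤ K * n →
    1 - η ≤
      ({M : Matrix (Fin m) (Fin n) (ZMod 2) | P n m M}.ncard : ℝ) /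
        (Nat.card (Matrix (Fin m) (Fin n) (ZMod 2)) : ℝ)

/-! A circuit of depth `d` with few wires has few gates of fan-in larger than
`q ≈ (log₂ n / 2)^(1/d)`. Fixing the values of these heavy gates in the most popular way keeps a
`2 ^ (-γ * n)` fraction, with `γ` small, of the inputs on which the circuit mostly agrees with `M`,
and on those every output bit is a function of at most `q ^ d ≤ log₂ n / 2` inputs. There are only
`exp (o(n) * m)` tuples of such juntas.

A fixed map `f`, on the other hand, mostly agrees with a random `M` on that many inputs with
probability only `exp (-Ω(n * m))`. Indeed, a set of so many inputs contains many linearly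
independent `k`-tuples, for some `k` linear in `n`; the images of such a tuple under `M` are
independent and uniform, and each of them has to lie in a small Hamming ball around the value of
`f`. Counting pairs of a matrix and such a tuple bounds the number of matrices, and a union bound
over the juntas finishes the argument. -/

open Finset Filter
open scoped Matrix

section Counting

theorem card_filter_map_mem_mul_card {G H : Type*} [AddGroup G] [Fintype G] [AddGroup H]
    [Fintype H] [DecidableEq H] {f : G →+ H} (hf : Function.Surjective f) (S : Finset H) :
    #{g | f g ∈ S} * Fintype.card H = Fintype.card G * #S := by
  have card_preimage (T : Finset H) : #{g | f g ∈ T} = #T * #{g | f g = 0} := by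
    rw [card_eq_sum_card_fiberwise (f := f) (t := T) fun g hg => by simpa using hg]
    refine sum_const_nat fun y hy => ?_
    rw [← AddMonoidHom.card_fiber_eq_of_mem_range f (hf y) (hf 0), filter_filter]
    congr 1
    ext g
    simp only [mem_filter, mem_univ, true_and, and_iff_right_iff_imp]
    rintro rfl
    exact hy
  have card_domain : Fintype.card G = Fintype.card H * #{g | f g = 0} := by
    simpa only [mem_univ, filter_true, card_univ] using card_preimage univ
  rw [card_preimage, card_domain]
  ring

variable {F : Type*} [Field F]

theorem exists_mulVec_eq_of_linearIndependent {ι κ J : Type*} [Fintype κ] {x : J → κ → F}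
    (hx : LinearIndependent F x) (y : J → ι → F) : ∃ M : Matrix ι κ F, ∀ j, M *ᵥ x j = y j := by
  classical
  obtain ⟨g, hg⟩ := (Finsupp.linearCombination F x).exists_leftInverse_of_injective
    (LinearMap.ker_eq_bot.2 hx)
  have hgx (j : J) : g (x j) = Finsupp.single j 1 := by
    simpa using LinearMap.congr_fun hg (Finsupp.single j 1)
  exact ⟨LinearMap.toMatrix' (Finsupp.linearCombination F y ∘ₗ g), fun j => by
    simp [LinearMap.toMatrix'_mulVec, hgx]⟩

section Tuples

variable {V : Type*} [AddCommGroup V] [Module F V]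

open scoped Classical in
variable (F) in
/-- The linearly independent `k`-tuples of vectors taken from `A`. -/
noncomputable def independentTuples (A : Finset V) (k : ℕ) : Finset (Fin k → V) :=
  {x ∈ Fintype.piFinset fun _ => A | LinearIndependent F x}

theorem mem_independentTuples {A : Finset V} {k : ℕ} {x : Fin k → V} :
    x ∈ independentTuples F A k ↔ (∀ j, x j ∈ A) ∧ LinearIndependent F x := by
  simp [independentTuples]

variable [Fintype F]

open scoped Classical in
theorem card_sub_pow_le_card_notMem_span {k : ℕ} {x : Fin k → V} (hx : LinearIndependent F x)
    (A : Finset V) :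
    #A - Fintype.card F ^ k ≤ #{v ∈ A | v ∉ Submodule.span F (Set.range x)} := by
  set U := Submodule.span F (Set.range x)
  have : Module.Finite F U := .span_of_finite F (Set.finite_range x)
  have : Finite U := Module.finite_of_finite F
  have card_span : (U : Set V).ncard = Fintype.card F ^ k := by
    rw [← Nat.card_coe_set_eq, SetLike.coe_sort_coe, Module.natCard_eq_pow_finrank (K := F),
      finrank_span_eq_card hx, Fintype.card_fin, Nat.card_eq_fintype_card]
  have card_mem_span : #{v ∈ A | v ∈ U} ≤ Fintype.card F ^ k := by
    rw [← card_span, ← Set.ncard_coe_finset]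
    exact Set.ncard_le_ncard (fun v hv => (mem_filter.1 hv).2) (Set.toFinite _)
  have := card_filter_add_card_filter_not (s := A) (· ∈ U)
  omega

theorem prod_card_sub_pow_le_card_independentTuples (A : Finset V) (k : ℕ) :
    ∏ i ∈ range k, (#A - Fintype.card F ^ i) ≤ #(independentTuples F A k) := by
  classical
  induction k with
  | zero =>
    rw [range_zero, prod_empty, one_le_card]
    exact ⟨Fin.elim0, mem_independentTuples.2 ⟨fun j => j.elim0, linearIndependent_empty_type⟩⟩
  | succ k ih =>
    let extensions (x : Fin k → V) : Finset V := {v ∈ A | v ∉ Submodule.span F (Set.range x)}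
    calc ∏ i ∈ range (k + 1), (#A - Fintype.card F ^ i)
        = (∏ i ∈ range k, (#A - Fintype.card F ^ i)) * (#A - Fintype.card F ^ k) :=
          prod_range_succ _ k
      _ ≤ #(independentTuples F A k) * (#A - Fintype.card F ^ k) := Nat.mul_le_mul_right _ ih
      _ ≤ ∑ x ∈ independentTuples F A k, #(extensions x) :=
          card_nsmul_le_sum _ _ _ fun x hx =>
            card_sub_pow_le_card_notMem_span (mem_independentTuples.1 hx).2 A
      _ = #((independentTuples F A k).sigma extensions) := (card_sigma _ _).symm
      _ ≤ #(independentTuples F A (k + 1)) := by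
          refine card_le_card_of_injOn (fun p => Fin.cons p.2 p.1) ?_ ?_
          · rintro ⟨x, v⟩ hxv
            obtain ⟨hx, hv⟩ := mem_sigma.1 (mem_coe.1 hxv)
            obtain ⟨hxA, hx_indep⟩ := mem_independentTuples.1 hx
            obtain ⟨hvA, hv_span⟩ := mem_filter.1 hv
            exact mem_independentTuples.2
              ⟨Fin.cases hvA hxA, linearIndependent_finCons.2 ⟨hx_indep, hv_span⟩⟩
          · rintro ⟨x, v⟩ - ⟨x', v'⟩ - h
            obtain ⟨rfl, rfl⟩ := Fin.cons_injective2 h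
            rfl

theorem pow_le_card_independentTuples {A : Finset V} {b k : ℕ}
    (hA : b + Fintype.card F ^ k ≤ #A) : b ^ k ≤ #(independentTuples F A k) := by
  refine le_trans ?_ (prod_card_sub_pow_le_card_independentTuples A k)
  conv_lhs => rw [← card_range k]
  refine pow_card_le_prod _ _ _ fun i hi => Nat.le_sub_of_add_le (le_trans ?_ hA)
  gcongr
  · exact Fintype.card_pos
  · exact (mem_range.1 hi).le

end Tuples

variable [Fintype F] [DecidableEq F] {ι κ : Type*} [Fintype ι] [Fintype κ] [DecidableEq ι]
  [DecidableEq κ]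

theorem card_mulVec_mem_mul_card_pow {k : ℕ} {x : Fin k → κ → F} (hx : LinearIndependent F x)
    (B : Fin k → Finset (ι → F)) :
    #{M : Matrix ι κ F | ∀ j, M *ᵥ x j ∈ B j} * Fintype.card (ι → F) ^ k =
      Fintype.card (Matrix ι κ F) * ∏ j, #(B j) := by
  let f : Matrix ι κ F →+ (Fin k → ι → F) :=
    AddMonoidHom.mk' (fun M j => M *ᵥ x j) fun M N => funext fun j => M.add_mulVec N (x j)
  have hf : Function.Surjective f := fun y =>
    (exists_mulVec_eq_of_linearIndependent hx y).imp fun _ hM => funext hM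
  simpa [f, Fintype.mem_piFinset] using card_filter_map_mem_mul_card hf (Fintype.piFinset B)

theorem card_mul_pow_le_sum_card_mulVec_mem {Φ : (κ → F) → Finset (ι → F)} {a b k : ℕ}
    (hab : b + Fintype.card F ^ k ≤ a) :
    #{M : Matrix ι κ F | a ≤ #{x | M *ᵥ x ∈ Φ x}} * b ^ k ≤
      ∑ x ∈ independentTuples F univ k, #{M : Matrix ι κ F | ∀ j, M *ᵥ x j ∈ Φ (x j)} := by
  classical
  calc #{M : Matrix ι κ F | a ≤ #{x | M *ᵥ x ∈ Φ x}} * b ^ k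
      ≤ ∑ M : Matrix ι κ F with a ≤ #{x | M *ᵥ x ∈ Φ x},
          #{x ∈ independentTuples F univ k | ∀ j, M *ᵥ x j ∈ Φ (x j)} := by
        refine card_nsmul_le_sum _ _ _ fun M hM => ?_
        refine (pow_le_card_independentTuples (hab.trans (mem_filter.1 hM).2)).trans_eq ?_
        congr 1
        ext x
        simp [mem_independentTuples, and_comm]
    _ ≤ ∑ M : Matrix ι κ F, #{x ∈ independentTuples F univ k | ∀ j, M *ᵥ x j ∈ Φ (x j)} :=
        sum_le_sum_of_subset (subset_univ _)
    _ = ∑ x ∈ independentTuples F univ k, #{M : Matrix ι κ F | ∀ j, M *ᵥ x j ∈ Φ (x j)} :=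
        (sum_card_bipartiteAbove_eq_sum_card_bipartiteBelow _).symm

theorem card_mul_pow_le_of_forall_card_le {Φ : (κ → F) → Finset (ι → F)} {β : ℝ}
    (hΦ : ∀ x, #(Φ x) ≤ β) {a b k : ℕ} (hab : b + Fintype.card F ^ k ≤ a) :
    (#{M : Matrix ι κ F | a ≤ #{x | M *ᵥ x ∈ Φ x}} : ℝ) * (b * Fintype.card (ι → F)) ^ k ≤
      Fintype.card (Matrix ι κ F) * (Fintype.card (κ → F) * β) ^ k := by
  have card_le (x) (hx : x ∈ independentTuples F univ k) :
      (#{M : Matrix ι κ F | ∀ j, M *ᵥ x j ∈ Φ (x j)} : ℝ) * Fintype.card (ι → F) ^ k ≤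
        Fintype.card (Matrix ι κ F) * β ^ k := by
    calc (#{M : Matrix ι κ F | ∀ j, M *ᵥ x j ∈ Φ (x j)} : ℝ) * Fintype.card (ι → F) ^ k
        = Fintype.card (Matrix ι κ F) * ∏ j, (#(Φ (x j)) : ℝ) := mod_cast
          card_mulVec_mem_mul_card_pow (mem_independentTuples.1 hx).2 fun j => Φ (x j)
      _ ≤ Fintype.card (Matrix ι κ F) * ∏ _j : Fin k, β := by gcongr; exact hΦ _
      _ = Fintype.card (Matrix ι κ F) * β ^ k := by rw [prod_const, card_univ, Fintype.card_fin]
  have card_tuples : #(independentTuples F (univ : Finset (κ → F)) k) ≤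
      Fintype.card (κ → F) ^ k := by
    simpa using card_le_univ (independentTuples F (univ : Finset (κ → F)) k)
  have hβ : 0 ≤ β := (Nat.cast_nonneg _).trans (hΦ 0)
  calc (#{M : Matrix ι κ F | a ≤ #{x | M *ᵥ x ∈ Φ x}} : ℝ) * (b * Fintype.card (ι → F)) ^ k
      = #{M : Matrix ι κ F | a ≤ #{x | M *ᵥ x ∈ Φ x}} * b ^ k * Fintype.card (ι → F) ^ k := by
        rw [mul_pow, mul_assoc]
    _ ≤ (∑ x ∈ independentTuples F univ k,
          (#{M : Matrix ι κ F | ∀ j, M *ᵥ x j ∈ Φ (x j)} : ℝ)) * Fintype.card (ι → F) ^ k := by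
        gcongr
        exact_mod_cast card_mul_pow_le_sum_card_mulVec_mem hab
    _ ≤ #(independentTuples F (univ : Finset (κ → F)) k) *
          (Fintype.card (Matrix ι κ F) * β ^ k) := by
        rw [sum_mul, ← nsmul_eq_mul]
        exact sum_le_card_nsmul _ _ _ card_le
    _ ≤ (Fintype.card (κ → F) : ℝ) ^ k * (Fintype.card (Matrix ι κ F) * β ^ k) := by
        gcongr
        exact_mod_cast card_tuples
    _ = Fintype.card (Matrix ι κ F) * (Fintype.card (κ → F) * β) ^ k := by ring

end Counting

section HammingBall

variable {ι α : Type*} [Fintype ι] [DecidableEq ι] [Fintype α] [DecidableEq α]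

theorem sum_pow_hammingDist {R : Type*} [CommSemiring R] (r : R) (z : ι → α) :
    ∑ y, r ^ hammingDist y z = (1 + (Fintype.card α - 1 : ℕ) * r) ^ Fintype.card ι := by
  have pow_eq_prod (y : ι → α) : r ^ hammingDist y z = ∏ i, if y i = z i then 1 else r := by
    simp [hammingDist, prod_ite]
  have sum_coordinate (i : ι) :
      ∑ b, (if b = z i then 1 else r) = 1 + (Fintype.card α - 1 : ℕ) * r := by
    simp [sum_ite, filter_eq', filter_ne', card_erase_of_mem]
  calc ∑ y, r ^ hammingDist y z = ∑ y : ι → α, ∏ i, if y i = z i then 1 else r :=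
        sum_congr rfl fun y _ => pow_eq_prod y
    _ = ∏ i, ∑ b, if b = z i then 1 else r := by rw [prod_univ_sum, Fintype.piFinset_univ]
    _ = (1 + (Fintype.card α - 1 : ℕ) * r) ^ Fintype.card ι := by
        simp only [sum_coordinate, prod_const, card_univ]

/-- The closed ball of radius `ρ` about `z` in the Hamming distance, with a real radius. -/
noncomputable def hammingBall (z : ι → α) (ρ : ℝ) : Finset (ι → α) :=
  {y | (hammingDist y z : ℝ) ≤ ρ}

theorem card_hammingBall_mul_exp_le (z : ι → α) {l : ℝ} (hl : 0 ≤ l) (ρ : ℝ) :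
    #(hammingBall z ρ) * Real.exp (-l * ρ) ≤
      (1 + (Fintype.card α - 1 : ℕ) * Real.exp (-l)) ^ Fintype.card ι := by
  rw [← sum_pow_hammingDist, ← nsmul_eq_mul]
  refine (card_nsmul_le_sum _ (fun y => Real.exp (-l) ^ hammingDist y z) _ fun y hy => ?_).trans
    (sum_le_sum_of_subset_of_nonneg (subset_univ _) fun y _ _ => by positivity)
  rw [← Real.exp_nat_mul, mul_comm (hammingDist y z : ℝ)]
  exact Real.exp_le_exp.2 (mul_le_mul_of_nonpos_left (mem_filter.1 hy).2 (by linarith))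

theorem card_hammingBall_half_le (hα : Fintype.card α = 2) (z : ι → α) {ε : ℝ} (hε : 0 ≤ ε) :
    (#(hammingBall z ((1 - ε) / 2 * Fintype.card ι)) : ℝ) ≤
      2 ^ Fintype.card ι * Real.exp (-(ε ^ 2 / 2) * Fintype.card ι) := by
  have one_add_exp_le : 1 + Real.exp (-(2 * ε)) ≤ 2 * Real.exp (-ε + ε ^ 2 / 2) := by
    calc 1 + Real.exp (-(2 * ε)) = 2 * (Real.exp (-ε) * Real.cosh ε) := by
          rw [Real.cosh_eq, mul_div_assoc', mul_add, ← Real.exp_add, ← Real.exp_add,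
            neg_add_cancel, Real.exp_zero]
          ring_nf
      _ ≤ 2 * (Real.exp (-ε) * Real.exp (ε ^ 2 / 2)) := by
          gcongr
          exact Real.cosh_le_exp_half_sq ε
      _ = 2 * Real.exp (-ε + ε ^ 2 / 2) := by rw [Real.exp_add]
  -- To first order in `ε`, the Chernoff bound is best at the exponent `2 * ε`.
  have h := card_hammingBall_mul_exp_le z (mul_nonneg zero_le_two hε)
    ((1 - ε) / 2 * Fintype.card ι)
  rw [hα, Nat.add_one_sub_one, Nat.cast_one, one_mul] at h
  refine le_of_mul_le_mul_right (h.trans ?_) (Real.exp_pos _)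
  calc (1 + Real.exp (-(2 * ε))) ^ Fintype.card ι
      ≤ (2 * Real.exp (-ε + ε ^ 2 / 2)) ^ Fintype.card ι := by gcongr
    _ = 2 ^ Fintype.card ι * Real.exp (-(ε ^ 2 / 2) * Fintype.card ι) *
          Real.exp (-(2 * ε) * ((1 - ε) / 2 * Fintype.card ι)) := by
        rw [mul_pow, ← Real.exp_nat_mul, mul_assoc, ← Real.exp_add]
        ring_nf

end HammingBall

section CloseInputs

variable {n m : ℕ}

/-- The inputs on which `f` agrees with the operator `M` in at least a `(1 + δ) / 2` fraction of
the output bits. -/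
noncomputable def closeInputs (δ : ℝ) (M : Matrix (Fin m) (Fin n) (ZMod 2))
    (f : (Fin n → ZMod 2) → Fin m → ZMod 2) : Finset (Fin n → ZMod 2) :=
  {x | M *ᵥ x ∈ hammingBall (f x) ((1 - δ) / 2 * m)}

theorem card_matrix_fin_zmod_two :
    Fintype.card (Matrix (Fin m) (Fin n) (ZMod 2)) = 2 ^ (m * n) := by
  rw [← Nat.card_eq_fintype_card, Matrix, Nat.card_fun, Nat.card_fun]
  simp [← pow_mul, mul_comm]

theorem card_two_pow_le_mul_card_closeInputs_le {k s : ℕ} {δ : ℝ} (hδ : 0 ≤ δ)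
    (hs : s + 1 + k ≤ n) (f : (Fin n → ZMod 2) → Fin m → ZMod 2) :
    (#{M : Matrix (Fin m) (Fin n) (ZMod 2) | 2 ^ n ≤ 2 ^ s * #(closeInputs δ M f)} : ℝ) ≤
      2 ^ (m * n) * (2 ^ (s + 1) * Real.exp (-(δ ^ 2 / 2) * m)) ^ k := by
  have card_ball (x : Fin n → ZMod 2) : (#(hammingBall (f x) ((1 - δ) / 2 * m)) : ℝ) ≤
      2 ^ m * Real.exp (-(δ ^ 2 / 2) * m) := by
    simpa using card_hammingBall_half_le (ZMod.card 2) (f x) hδ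
  have two_pow_le_iff (N : ℕ) : 2 ^ n ≤ 2 ^ s * N ↔ 2 ^ (n - s) ≤ N := by
    rw [show 2 ^ n = 2 ^ s * 2 ^ (n - s) by rw [← pow_add]; congr 1; omega]
    exact mul_le_mul_iff_right₀ (by positivity)
  have two_pow_add_le : 2 ^ (n - (s + 1)) + Fintype.card (ZMod 2) ^ k ≤ 2 ^ (n - s) := by
    have hk : 2 ^ k ≤ 2 ^ (n - (s + 1)) := Nat.pow_le_pow_right two_pos (by omega)
    rw [ZMod.card, show n - s = n - (s + 1) + 1 by omega, pow_succ]
    omega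
  have h := card_mul_pow_le_of_forall_card_le card_ball two_pow_add_le
  simp only [card_matrix_fin_zmod_two, Fintype.card_pi_const, ZMod.card] at h
  push_cast at h
  simp only [two_pow_le_iff]
  refine le_of_mul_le_mul_right (h.trans_eq ?_)
    (by positivity : (0 : ℝ) < (2 ^ (n - (s + 1)) * 2 ^ m) ^ k)
  rw [mul_assoc, ← mul_pow, show (2 : ℝ) ^ n = 2 ^ (s + 1) * 2 ^ (n - (s + 1)) by
    rw [← pow_add]; congr 1; omega]
  ring

end CloseInputs

section Juntas

theorem exists_eqOn_comp_of_card_le {ι α β : Type*} [Nonempty ι] [Nonempty β] {t : ℕ}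
    {f : (ι → α) → β} {X : Set (ι → α)} {S : Finset ι} (hS : #S ≤ t)
    (hf : ∀ x ∈ X, ∀ y ∈ X, (∀ i ∈ S, x i = y i) → f x = f y) :
    ∃ (e : Fin t → ι) (g : (Fin t → α) → β), Set.EqOn f (fun x => g fun j => x (e j)) X := by
  obtain ⟨φ⟩ := Function.Embedding.nonempty_of_card_le (α := S) (β := Fin t) (by simpa using hS)
  let e : Fin t → ι := Function.extend φ Subtype.val fun _ => Classical.arbitrary ι
  have he (i : S) : e (φ i) = i := φ.injective.extend_apply _ _ i
  have hfactors : (fun x : X => f x).FactorsThrough fun (x : X) j => x.1 (e j) :=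
    fun x y hxy => hf x x.2 y y.2 fun i hi => by simpa [he] using congrFun hxy (φ ⟨i, hi⟩)
  obtain ⟨g, hg⟩ := (Function.factorsThrough_iff _).1 hfactors
  exact ⟨e, g, fun x hx => congrFun hg ⟨x, hx⟩⟩

/-- A Boolean function of `n` bits that reads at most `t` of them: the positions read, which may
repeat, and the function applied to the bits found there. -/
abbrev Junta (n t : ℕ) : Type :=
  (Fin t → Fin n) × ((Fin t → ZMod 2) → ZMod 2)

variable {n m t : ℕ}

/-- The map whose output bits are computed by the juntas `p`. -/
def juntaMap (p : Fin m → Junta n t) (x : Fin n → ZMod 2) (i : Fin m) : ZMod 2 :=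
  (p i).2 fun j => x ((p i).1 j)

theorem card_junta : Fintype.card (Junta n t) = n ^ t * 2 ^ 2 ^ t := by
  simp [Junta]

open scoped Classical in
/-- The `m × n` matrices for which some tuple of `t`-juntas agrees with the matrix in at least a
`(1 + δ) / 2` fraction of the output bits on at least a `2⁻ˢ` fraction of the inputs. -/
noncomputable def juntaApproximable (n m : ℕ) (δ : ℝ) (t s : ℕ) :
    Finset (Matrix (Fin m) (Fin n) (ZMod 2)) :=
  {M | ∃ p : Fin m → Junta n t, 2 ^ n ≤ 2 ^ s * #(closeInputs δ M (juntaMap p))}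

theorem card_juntaApproximable_le {k s : ℕ} {δ : ℝ} (hδ : 0 ≤ δ) (hs : s + 1 + k ≤ n) :
    (#(juntaApproximable n m δ t s) : ℝ) ≤
      2 ^ (m * n) *
        ((n ^ t * 2 ^ 2 ^ t) ^ m * (2 ^ (s + 1) * Real.exp (-(δ ^ 2 / 2) * m)) ^ k) := by
  classical
  have eq_biUnion : juntaApproximable n m δ t s = univ.biUnion fun p : Fin m → Junta n t =>
      {M | 2 ^ n ≤ 2 ^ s * #(closeInputs δ M (juntaMap p))} := by
    ext M
    simp [juntaApproximable]
  calc (#(juntaApproximable n m δ t s) : ℝ)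
      ≤ ∑ p : Fin m → Junta n t,
          (#{M | 2 ^ n ≤ 2 ^ s * #(closeInputs δ M (juntaMap p))} : ℝ) := by
        rw [eq_biUnion]
        exact_mod_cast card_biUnion_le
    _ ≤ ∑ _p : Fin m → Junta n t,
          2 ^ (m * n) * (2 ^ (s + 1) * Real.exp (-(δ ^ 2 / 2) * m)) ^ k :=
        sum_le_sum fun p _ => card_two_pow_le_mul_card_closeInputs_le hδ hs (juntaMap p)
    _ = _ := by
        rw [sum_const, card_univ, Fintype.card_pi_const, card_junta, nsmul_eq_mul]
        push_cast
        ring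

end Juntas

namespace Circuit

variable {n m : ℕ} (C : Circuit n m)

theorem nodeDepth_lt_gateDepth {g : Fin C.size} {v : Fin n ⊕ Fin C.size} (hv : v ∈ C.preds g) :
    C.nodeDepth v < C.gateDepth g := by
  rw [C.gateDepth_eq]
  exact le_sup (f := fun v => C.nodeDepth v + 1) hv

/-- The gates of fan-in larger than `q`. -/
def heavyGates (q : ℕ) : Finset (Fin C.size) :=
  {g | q < #(C.preds g)}

theorem card_heavyGates_mul_le_wires (q : ℕ) : #(C.heavyGates q) * (q + 1) ≤ C.wires :=
  (card_nsmul_le_sum _ (fun g => #(C.preds g)) _ fun _ hg => (mem_filter.1 hg).2).trans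
    (sum_le_sum_of_subset (subset_univ _))

theorem exists_card_le_pow_nodeDepth_forall_nodeVal_eq {q : ℕ} (hq : 1 ≤ q)
    (v : Fin n ⊕ Fin C.size) :
    ∃ S : Finset (Fin n), #S ≤ q ^ C.nodeDepth v ∧ ∀ x y : Fin n → ZMod 2,
      (∀ g ∈ C.heavyGates q, C.gateVal x g = C.gateVal y g) → (∀ i ∈ S, x i = y i) →
        C.nodeVal x v = C.nodeVal y v := by
  induction hD : C.nodeDepth v using Nat.strong_induction_on generalizing v with
  | _ D ih =>
  subst hD
  rcases v with i | g
  · exact ⟨{i}, by simp [nodeDepth], fun x y _ hxy => hxy i (mem_singleton_self i)⟩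
  by_cases hg : g ∈ C.heavyGates q
  · exact ⟨∅, by simp, fun x y hxy _ => hxy g hg⟩
  have fanIn_le : #(C.preds g) ≤ q := by simpa [heavyGates] using hg
  choose! S hS using fun v (hv : v ∈ C.preds g) => ih _ (C.nodeDepth_lt_gateDepth hv) v rfl
  refine ⟨(C.preds g).biUnion S, ?_, fun x y hheavy hxy => ?_⟩
  · rcases (C.preds g).eq_empty_or_nonempty with hempty | ⟨u, hu⟩
    · simp [hempty]
    calc #((C.preds g).biUnion S) ≤ #(C.preds g) * q ^ (C.gateDepth g - 1) :=
          card_biUnion_le_card_mul _ _ _ fun v hv => (hS v hv).1.trans <|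
            Nat.pow_le_pow_right hq (Nat.le_sub_one_of_lt (C.nodeDepth_lt_gateDepth hv))
      _ ≤ q * q ^ (C.gateDepth g - 1) := Nat.mul_le_mul_right _ fanIn_le
      _ = q ^ C.gateDepth g := mul_pow_sub_one (C.nodeDepth_lt_gateDepth hu).ne_bot q
  · change C.gateVal x g = C.gateVal y g
    rw [C.gateVal_eq, C.gateVal_eq]
    congr 1
    funext v
    exact (hS v v.2).2 x y hheavy fun i hi => hxy i (mem_biUnion.2 ⟨v, v.2, hi⟩)

variable {d q t : ℕ}

theorem exists_juntaMap_eqOn (hn : 0 < n) (hd : C.depth ≤ d) (hq : 1 ≤ q) (hqt : q ^ d ≤ t)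
    {X : Set (Fin n → ZMod 2)}
    (hX : ∀ x ∈ X, ∀ y ∈ X, ∀ g ∈ C.heavyGates q, C.gateVal x g = C.gateVal y g) :
    ∃ p : Fin m → Junta n t, Set.EqOn C.eval (juntaMap p) X := by
  have : Nonempty (Fin n) := ⟨⟨0, hn⟩⟩
  have exists_junta (i : Fin m) :
      ∃ p : Junta n t, Set.EqOn (C.eval · i) (fun x => p.2 fun j => x (p.1 j)) X := by
    obtain ⟨S, card_S, hS⟩ := C.exists_card_le_pow_nodeDepth_forall_nodeVal_eq hq (C.out i)
    have depth_out : C.nodeDepth (C.out i) ≤ d :=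
      (le_sup (f := fun i => C.nodeDepth (C.out i)) (mem_univ i)).trans hd
    obtain ⟨e, g, hg⟩ := exists_eqOn_comp_of_card_le
      (card_S.trans ((Nat.pow_le_pow_right hq depth_out).trans hqt))
      fun x hx y hy => hS x y (hX x hx y hy)
    exact ⟨(e, g), hg⟩
  choose p hp using exists_junta
  exact ⟨p, fun x hx => funext fun i => hp i hx⟩

theorem exists_card_le_mul_card_eq_juntaMap (hn : 0 < n) (hd : C.depth ≤ d) (hq : 1 ≤ q)
    (hqt : q ^ d ≤ t) (G : Finset (Fin n → ZMod 2)) :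
    ∃ p : Fin m → Junta n t,
      #G ≤ 2 ^ #(C.heavyGates q) * #{x ∈ G | C.eval x = juntaMap p x} := by
  let heavyVal (x : Fin n → ZMod 2) (g : C.heavyGates q) : ZMod 2 := C.gateVal x g
  obtain ⟨a, -, ha⟩ := exists_le_card_fiber_of_nsmul_le_card_of_maps_to (s := G) (f := heavyVal)
    (b := (#G / 2 ^ #(C.heavyGates q) : ℝ)) (fun x _ => mem_univ (heavyVal x)) univ_nonempty
    (by simp [mul_div_cancel₀])
  rw [div_le_iff₀' (by positivity)] at ha
  obtain ⟨p, hp⟩ := C.exists_juntaMap_eqOn (X := {x | heavyVal x = a}) hn hd hq hqt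
    fun x hx y hy g hg => congrFun (hx.trans hy.symm) ⟨g, hg⟩
  refine ⟨p, ?_⟩
  calc #G ≤ 2 ^ #(C.heavyGates q) * #{x ∈ G | heavyVal x = a} := mod_cast ha
    _ ≤ 2 ^ #(C.heavyGates q) * #{x ∈ G | C.eval x = juntaMap p x} := by
        gcongr with x
        exact fun hx => hp hx

theorem exists_card_closeInputs_le_mul (hn : 0 < n) (hd : C.depth ≤ d) (hq : 1 ≤ q)
    (hqt : q ^ d ≤ t) (δ : ℝ) (M : Matrix (Fin m) (Fin n) (ZMod 2)) :
    ∃ p : Fin m → Junta n t,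
      #(closeInputs δ M C.eval) ≤ 2 ^ #(C.heavyGates q) * #(closeInputs δ M (juntaMap p)) := by
  obtain ⟨p, hp⟩ := C.exists_card_le_mul_card_eq_juntaMap hn hd hq hqt (closeInputs δ M C.eval)
  refine ⟨p, hp.trans ?_⟩
  gcongr
  intro x hx
  simp only [closeInputs, mem_filter, mem_univ, true_and] at hx ⊢
  rw [← hx.2]
  exact hx.1

variable {C} {M : Matrix (Fin m) (Fin n) (ZMod 2)}

theorem Computes.hasAdvantage_one (h : C.Computes M) : C.HasAdvantage 1 M := fun i => by
  simp [h _]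

theorem HasAdvantage.sum_hammingDist_le {ε : ℝ} (h : C.HasAdvantage ε M) :
    ∑ x, (hammingDist (M *ᵥ x) (C.eval x) : ℝ) ≤ (1 - ε) / 2 * m * 2 ^ n := by
  have card_ne_le (i : Fin m) :
      (#{x | (M *ᵥ x) i ≠ C.eval x i} : ℝ) ≤ (1 - ε) / 2 * 2 ^ n := by
    have hi := (le_div_iff₀ (by positivity)).1 (h i)
    have hcompl : (#{x | C.eval x i = (M *ᵥ x) i} : ℝ) + #{x | ¬C.eval x i = (M *ᵥ x) i} =
        2 ^ n := by
      exact_mod_cast (card_filter_add_card_filter_not _).trans (by simp)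
    simp only [ne_comm (a := (M *ᵥ _) i), ne_eq]
    linarith
  calc ∑ x, (hammingDist (M *ᵥ x) (C.eval x) : ℝ)
      = ∑ i, (#{x | (M *ᵥ x) i ≠ C.eval x i} : ℝ) := mod_cast
        sum_card_bipartiteAbove_eq_sum_card_bipartiteBelow fun x i => (M *ᵥ x) i ≠ C.eval x i
    _ ≤ ∑ _i : Fin m, (1 - ε) / 2 * 2 ^ n := sum_le_sum fun i _ => card_ne_le i
    _ = (1 - ε) / 2 * m * 2 ^ n := by
        rw [sum_const, card_univ, Fintype.card_fin, nsmul_eq_mul]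
        ring

theorem HasAdvantage.le_card_closeInputs {ε δ : ℝ} (hm : 0 < m) (hδ : -1 ≤ δ)
    (h : C.HasAdvantage ε M) : (ε - δ) / 2 * 2 ^ n ≤ #(closeInputs δ M C.eval) := by
  have le_hammingDist_add (x : Fin n → ZMod 2) : (1 - δ) / 2 * m ≤
      hammingDist (M *ᵥ x) (C.eval x) + if x ∈ closeInputs δ M C.eval then (m : ℝ) else 0 := by
    by_cases hx : x ∈ closeInputs δ M C.eval
    · rw [if_pos hx]
      nlinarith [(Nat.cast_nonneg (hammingDist (M *ᵥ x) (C.eval x)) : (0 : ℝ) ≤ _),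
        (Nat.cast_nonneg m : (0 : ℝ) ≤ m)]
    · rw [if_neg hx, add_zero]
      simp only [closeInputs, hammingBall, mem_filter, mem_univ, true_and, not_le] at hx
      exact hx.le
  have hsum := sum_le_sum fun x (_ : x ∈ univ) => le_hammingDist_add x
  rw [sum_add_distrib, ← sum_filter, filter_mem_eq_inter, univ_inter] at hsum
  simp only [sum_const, card_univ, Fintype.card_pi_const, ZMod.card, nsmul_eq_mul] at hsum
  push_cast at hsum
  refine le_of_mul_le_mul_right ?_ (Nat.cast_pos.2 hm : (0 : ℝ) < m)
  linarith [h.sum_hammingDist_le]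

end Circuit

section Parameters

theorem logb_rpow_le_nthRoot {d : ℕ} (hd : d ≠ 0) (n : ℕ) :
    Real.logb 2 n ^ (1 / d : ℝ) ≤ 2 * (Nat.nthRoot d (Nat.log 2 n / 2) + 1) := by
  set t := Nat.log 2 n / 2
  set q := Nat.nthRoot d t
  have lt_pow : t < (q + 1) ^ d := Nat.lt_pow_nthRoot_add_one hd t
  have logb_le : Real.logb 2 n ≤ 2 * (t + 1) := by
    calc Real.logb 2 n ≤ ⌊Real.logb (2 : ℕ) n⌋₊ + 1 := (Nat.lt_floor_add_one _).le
      _ = (Nat.log 2 n + 1 : ℕ) := by rw [Real.natFloor_logb_natCast, Nat.cast_succ]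
      _ ≤ (2 * (t + 1) : ℕ) := by gcongr; omega
      _ = 2 * (t + 1) := by push_cast; rfl
  have le_pow : Real.logb 2 n ≤ (2 * (q + 1) : ℝ) ^ d := by
    calc Real.logb 2 n ≤ 2 * (t + 1) := logb_le
      _ ≤ 2 * (q + 1) ^ d := by
          gcongr
          exact_mod_cast lt_pow
      _ ≤ 2 ^ d * (q + 1) ^ d := by
          gcongr
          exact le_self_pow₀ one_le_two hd
      _ = (2 * (q + 1) : ℝ) ^ d := (mul_pow _ _ _).symm
  have logb_nonneg : 0 ≤ Real.logb 2 n := (Nat.cast_nonneg _).trans (Real.natLog_le_logb n 2)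
  rw [one_div]
  refine (Real.rpow_le_rpow logb_nonneg le_pow (by positivity)).trans_eq ?_
  exact Real.pow_rpow_inv_natCast (by positivity) hd

theorem two_pow_le_exp (k : ℕ) : (2 : ℝ) ^ k ≤ Real.exp k := by
  rw [← Real.exp_one_pow]
  gcongr
  linarith [Real.add_one_le_exp 1]

theorem pow_mul_two_pow_two_pow_le_exp {n : ℕ} (hn : n ≠ 0) :
    (n : ℝ) ^ (Nat.log 2 n / 2) * 2 ^ 2 ^ (Nat.log 2 n / 2) ≤
      Real.exp (√n * (Real.log n + 1)) := by
  set t := Nat.log 2 n / 2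
  have two_pow_le_sqrt : ((2 ^ t : ℕ) : ℝ) ≤ √n := by
    refine Real.le_sqrt_of_sq_le ?_
    rw [← Nat.cast_pow, ← pow_mul, Nat.cast_le]
    exact Nat.pow_le_of_le_log hn (Nat.div_mul_le_self _ _)
  have le_sqrt : (t : ℝ) ≤ √n :=
    (Nat.cast_le.2 Nat.lt_two_pow_self.le).trans two_pow_le_sqrt
  have := Real.log_natCast_nonneg n
  calc (n : ℝ) ^ t * 2 ^ 2 ^ t ≤ Real.exp (Real.log n) ^ t * Real.exp (2 ^ t : ℕ) := by
        gcongr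
        · exact Real.le_exp_log _
        · exact two_pow_le_exp _
    _ = Real.exp (t * Real.log n + (2 ^ t : ℕ)) := by
        rw [← Real.exp_nat_mul, ← Real.exp_add]
    _ ≤ Real.exp (√n * Real.log n + √n) := by gcongr
    _ = Real.exp (√n * (Real.log n + 1)) := by rw [mul_add, mul_one]

theorem eventually_sqrt_mul_log_add_one_le {a : ℝ} (ha : 0 < a) :
    ∀ᶠ n : ℕ in atTop, √n * (Real.log n + 1) ≤ a * n := by
  have hlittle : (fun x : ℝ => Real.log x + 1) =o[atTop] fun x : ℝ => √x := by
    simp only [Real.sqrt_eq_rpow]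
    refine (isLittleO_log_rpow_atTop one_half_pos).add
      (Asymptotics.isLittleO_const_left.2 (.inr ?_))
    exact tendsto_norm_atTop_atTop.comp (tendsto_rpow_atTop one_half_pos)
  filter_upwards [(hlittle.bound ha).natCast_atTop] with n hn
  rw [Real.norm_of_nonneg (Real.sqrt_nonneg _)] at hn
  calc √n * (Real.log n + 1) ≤ √n * (a * √n) := by
        gcongr
        exact (Real.le_norm_self _).trans hn
    _ = a * n := by rw [mul_left_comm, Real.mul_self_sqrt (Nat.cast_nonneg n)]

end Parameters

section WireBound

variable {n m d : ℕ}

theorem Circuit.card_heavyGates_le {c : ℝ} (hc : 0 ≤ c) (hd : d ≠ 0) {C : Circuit n m}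
    (hwires : C.wires < c * (n * Real.logb 2 n ^ (1 / d : ℝ))) :
    (#(C.heavyGates (Nat.nthRoot d (Nat.log 2 n / 2))) : ℝ) ≤ 2 * c * n := by
  set q := Nat.nthRoot d (Nat.log 2 n / 2)
  refine le_of_mul_le_mul_right ?_ (by positivity : (0 : ℝ) < q + 1)
  calc (#(C.heavyGates q) * (q + 1) : ℝ) ≤ C.wires := mod_cast C.card_heavyGates_mul_le_wires q
    _ ≤ c * (n * Real.logb 2 n ^ (1 / d : ℝ)) := hwires.le
    _ ≤ c * (n * (2 * (q + 1))) := by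
        gcongr
        exact logb_rpow_le_nthRoot hd n
    _ = 2 * c * n * (q + 1) := by ring

theorem Circuit.HasAdvantage.mem_juntaApproximable {ε c : ℝ} {r : ℕ} (hn : 4 ≤ n) (hm : 0 < m)
    (hr : 1 ≤ ε / 4 * 2 ^ r) (hc : 0 ≤ c) (hd : d ≠ 0) {C : Circuit n m}
    {M : Matrix (Fin m) (Fin n) (ZMod 2)} (hC : C.HasAdvantage ε M) (hdepth : C.depth ≤ d)
    (hwires : C.wires < c * (n * Real.logb 2 n ^ (1 / d : ℝ))) :
    M ∈ juntaApproximable n m (ε / 2) (Nat.log 2 n / 2) (r + ⌊2 * c * n⌋₊) := by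
  set t := Nat.log 2 n / 2
  set q := Nat.nthRoot d t
  have one_le_t : 1 ≤ t := by
    have : 2 ≤ Nat.log 2 n := Nat.le_log_of_pow_le one_lt_two hn
    omega
  have one_le_q : 1 ≤ q := (Nat.le_nthRoot_iff hd).2 ((one_pow d).trans_le one_le_t)
  have card_heavy : #(C.heavyGates q) ≤ ⌊2 * c * n⌋₊ :=
    Nat.le_floor (C.card_heavyGates_le hc hd hwires)
  obtain ⟨p, hp⟩ := C.exists_card_closeInputs_le_mul (by omega) hdepth one_le_q
    (Nat.pow_nthRoot_le (.inl hd)) (ε / 2) M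
  have hε : 0 < ε / 4 := pos_of_mul_pos_left (zero_lt_one.trans_le hr) (by positivity)
  have card_close : ε / 4 * 2 ^ n ≤ #(closeInputs (ε / 2) M C.eval) := by
    convert hC.le_card_closeInputs hm (by linarith : -1 ≤ ε / 2) using 2
    ring
  refine mem_filter.2 ⟨mem_univ _, p, ?_⟩
  rw [← Nat.cast_le (α := ℝ)]
  push_cast
  calc (2 : ℝ) ^ n ≤ ε / 4 * 2 ^ r * 2 ^ n := le_mul_of_one_le_left (by positivity) hr
    _ = 2 ^ r * (ε / 4 * 2 ^ n) := by ring
    _ ≤ 2 ^ r * #(closeInputs (ε / 2) M C.eval) := by gcongr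
    _ ≤ 2 ^ r * (2 ^ #(C.heavyGates q) * #(closeInputs (ε / 2) M (juntaMap p))) := by
        gcongr
        exact_mod_cast hp
    _ ≤ 2 ^ r * (2 ^ ⌊2 * c * n⌋₊ * #(closeInputs (ε / 2) M (juntaMap p))) := by
        gcongr
        exact one_le_two
    _ = 2 ^ (r + ⌊2 * c * n⌋₊) * #(closeInputs (ε / 2) M (juntaMap p)) := by
        rw [pow_add, mul_assoc (2 ^ r)]

end WireBound

section MostOperators

theorem card_juntaApproximable_le_exp {n m t k s : ℕ} {δ : ℝ} (hδ : 0 ≤ δ) (hs : s + 1 + k ≤ n)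
    (hjunta : (n : ℝ) ^ t * 2 ^ 2 ^ t ≤ Real.exp (δ ^ 2 / 8 * k))
    (hinputs : (2 : ℝ) ^ (s + 1) ≤ Real.exp (δ ^ 2 / 8 * m)) :
    (#(juntaApproximable n m δ t s) : ℝ) ≤
      2 ^ (m * n) * Real.exp (-(δ ^ 2 / 4) * (k * m)) := by
  refine (card_juntaApproximable_le hδ hs).trans ?_
  gcongr
  calc ((n : ℝ) ^ t * 2 ^ 2 ^ t) ^ m * (2 ^ (s + 1) * Real.exp (-(δ ^ 2 / 2) * m)) ^ k
      ≤ Real.exp (δ ^ 2 / 8 * k) ^ m *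
          (Real.exp (δ ^ 2 / 8 * m) * Real.exp (-(δ ^ 2 / 2) * m)) ^ k := by gcongr
    _ = Real.exp (-(δ ^ 2 / 4) * (k * m)) := by
        rw [← Real.exp_add, ← Real.exp_nat_mul, ← Real.exp_nat_mul, ← Real.exp_add]
        ring_nf

theorem eventually_card_juntaApproximable_le {δ b : ℝ} (hδ : 0 < δ) (hb : 0 ≤ b)
    (hbδ : b ≤ δ ^ 2 / 16) (hb_half : b ≤ 1 / 2) (r : ℕ) :
    ∀ᶠ n : ℕ in atTop, ∀ m, n ≤ m →
      (#(juntaApproximable n m δ (Nat.log 2 n / 2) (r + ⌊b * n⌋₊)) : ℝ) ≤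
        2 ^ (m * n) * Real.exp (-(δ ^ 2 / 32) * (n * m)) := by
  have eventually_r_le : ∀ᶠ n : ℕ in atTop, (r + 1 : ℝ) ≤ δ ^ 2 / 16 * n :=
    (tendsto_natCast_atTop_atTop.const_mul_atTop (by positivity)).eventually_ge_atTop _
  filter_upwards [eventually_r_le, eventually_ge_atTop (4 * (r + 1)),
    eventually_sqrt_mul_log_add_one_le (by positivity : 0 < δ ^ 2 / 64)]
    with n hrn hn hsqrt m hnm
  have floor_le {c : ℝ} (hbc : b ≤ c) : (⌊b * n⌋₊ : ℝ) ≤ c * n :=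
    (Nat.floor_le (by positivity)).trans (by gcongr)
  have two_mul_floor_le : 2 * ⌊b * n⌋₊ ≤ n := by
    rw [← Nat.cast_le (α := ℝ)]
    push_cast
    linarith [floor_le hb_half]
  have le_eight_mul : (n : ℝ) ≤ 8 * (n / 4 : ℕ) := mod_cast (by omega : n ≤ 8 * (n / 4))
  refine (card_juntaApproximable_le_exp (k := n / 4) hδ.le (by omega) ?_ ?_).trans ?_
  · refine (pow_mul_two_pow_two_pow_le_exp (by omega)).trans (Real.exp_le_exp.2 (hsqrt.trans ?_))
    calc δ ^ 2 / 64 * n ≤ δ ^ 2 / 64 * (8 * (n / 4 : ℕ)) := by gcongr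
      _ = δ ^ 2 / 8 * (n / 4 : ℕ) := by ring
  · refine (two_pow_le_exp _).trans (Real.exp_le_exp.2 ?_)
    calc ((r + ⌊b * n⌋₊ + 1 : ℕ) : ℝ) ≤ δ ^ 2 / 8 * n := by
          push_cast
          linarith [floor_le hbδ]
      _ ≤ δ ^ 2 / 8 * m := by gcongr
  · gcongr 2 ^ (m * n) * Real.exp ?_
    calc -(δ ^ 2 / 4) * ((n / 4 : ℕ) * m : ℝ) = -(δ ^ 2 / 32) * (8 * (n / 4 : ℕ) * m) := by ring
      _ ≤ -(δ ^ 2 / 32) * (n * m) :=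
          mul_le_mul_of_nonpos_left (by gcongr) (by linarith [sq_nonneg δ])

theorem one_sub_le_ncard_div_card {α : Type*} [Fintype α] [Nonempty α] {P : α → Prop}
    {B : Finset α} {η : ℝ} (hB : #B ≤ Fintype.card α * η) (hP : ∀ a ∉ B, P a) :
    1 - η ≤ ({a | P a}.ncard : ℝ) / Nat.card α := by
  classical
  have card_compl_le : #Bᶜ ≤ {a | P a}.ncard := by
    rw [← Set.ncard_coe_finset]
    exact Set.ncard_le_ncard fun a ha => hP a (by simpa using ha)
  have card_add : (#B + #Bᶜ : ℝ) = Fintype.card α := mod_cast card_add_card_compl B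
  rw [Nat.card_eq_fintype_card, le_div_iff₀ (mod_cast Fintype.card_pos)]
  linarith [(Nat.cast_le (α := ℝ)).2 card_compl_le]

theorem ForMostOperators.mono {P Q : (n m : ℕ) → Matrix (Fin m) (Fin n) (ZMod 2) → Prop}
    (hP : ForMostOperators P) (hPQ : ∀ n m M, P n m M → Q n m M) : ForMostOperators Q := by
  intro K η hη
  filter_upwards [hP K η hη] with n hn m hnm hmK
  refine (hn m hnm hmK).trans ?_
  gcongr
  · exact Set.toFinite _
  · exact hPQ n m _

theorem forMostOperators_of_one_sub_exp_le {a : ℝ} (ha : 0 < a)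
    {P : (n m : ℕ) → Matrix (Fin m) (Fin n) (ZMod 2) → Prop}
    (hP : ∀ᶠ n : ℕ in atTop, ∀ m, n ≤ m → 1 - Real.exp (-a * (n * m)) ≤
      ({M | P n m M}.ncard : ℝ) / Nat.card (Matrix (Fin m) (Fin n) (ZMod 2))) :
    ForMostOperators P := by
  intro K η hη
  have tendsto_exp : Tendsto (fun n : ℕ => Real.exp (-(a * n))) atTop (nhds 0) :=
    Real.tendsto_exp_neg_atTop_nhds_zero.comp
      (tendsto_natCast_atTop_atTop.const_mul_atTop ha)
  filter_upwards [hP, tendsto_exp.eventually_le_const hη, eventually_ge_atTop 1]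
    with n hn hexp one_le_n m hnm _
  refine le_trans (sub_le_sub_left (le_trans ?_ hexp) 1) (hn m hnm)
  rw [neg_mul, Real.exp_le_exp, neg_le_neg_iff]
  gcongr
  exact le_mul_of_one_le_right (Nat.cast_nonneg n) (mod_cast one_le_n.trans hnm)

theorem theorem4p1_general {ε : ℝ} (hε : 0 < ε) :
    ∃ c : ℝ, 0 < c ∧ ∃ a : ℝ, 0 < a ∧ ∀ᶠ n : ℕ in atTop, ∀ m, n ≤ m →
      1 - Real.exp (-a * (n * m)) ≤
        ({M : Matrix (Fin m) (Fin n) (ZMod 2) |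
          ∀ d : ℕ, 1 ≤ d → ∀ C : Circuit n m, C.depth ≤ d → C.HasAdvantage ε M →
            c * (n * Real.logb 2 n ^ (1 / d : ℝ)) ≤ C.wires}.ncard : ℝ) /
          Nat.card (Matrix (Fin m) (Fin n) (ZMod 2)) := by
  set b : ℝ := min ((ε / 2) ^ 2 / 16) (1 / 2)
  have hb : 0 < b := by positivity
  obtain ⟨r, hr⟩ := pow_unbounded_of_one_lt (4 / ε) one_lt_two
  have one_le : 1 ≤ ε / 4 * 2 ^ r := by
    rw [div_lt_iff₀ hε] at hr
    linarith
  refine ⟨b / 2, by positivity, (ε / 2) ^ 2 / 32, by positivity, ?_⟩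
  filter_upwards [eventually_ge_atTop 4, eventually_card_juntaApproximable_le (half_pos hε) hb.le
    (min_le_left _ _) (min_le_right _ _) r] with n hn card_le m hnm
  refine one_sub_le_ncard_div_card
    (B := juntaApproximable n m (ε / 2) (Nat.log 2 n / 2) (r + ⌊b * n⌋₊)) ?_
    fun M hM d hd C hdepth hC => ?_
  · rw [card_matrix_fin_zmod_two]
    exact_mod_cast card_le m hnm
  · by_contra! hwires
    have hmem := hC.mem_juntaApproximable hn (by omega) one_le (by positivity) (by omega) hdepth
      hwires
    rw [mul_div_cancel₀ b two_ne_zero] at hmem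
    exact hM hmem

end MostOperators

theorem theorem4p1 :
    (∃ c : ℝ, 0 < c ∧
      ForMostOperators fun n m M =>
        ∀ d : ℕ, 1 ≤ d → ∀ C : Circuit n m, C.depth ≤ d → C.Computes M →
          c * (n * Real.logb 2 n ^ (1 / d : ℝ)) ≤ C.wires) ∧
    (∀ ε : ℝ, 0 < ε → ∃ c : ℝ, 0 < c ∧
      ForMostOperators fun n m M =>
        ∀ d : ℕ, 1 ≤ d → ∀ C : Circuit n m, C.depth ≤ d → C.HasAdvantage ε M →
          c * (n * Real.logb 2 n ^ (1 / d : ℝ)) ≤ C.wires) := by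
  have advantage (ε : ℝ) (hε : 0 < ε) :
      ∃ c : ℝ, 0 < c ∧ ForMostOperators fun n m M =>
        ∀ d : ℕ, 1 ≤ d → ∀ C : Circuit n m, C.depth ≤ d → C.HasAdvantage ε M →
          c * (n * Real.logb 2 n ^ (1 / d : ℝ)) ≤ C.wires := by
    obtain ⟨c, hc, a, ha, h⟩ := theorem4p1_general hε
    exact ⟨c, hc, forMostOperators_of_one_sub_exp_le ha h⟩
  refine ⟨?_, advantage⟩
  obtain ⟨c, hc, h⟩ := advantage 1 one_pos
  exact ⟨c, hc, h.mono fun n m M hM d hd C hdepth hC => hM d hd C hdepth hC.hasAdvantage_one⟩
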